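/- A disjunctive identity (d-identity) is a sentence $\forall x_0,x_1,\dots\;[(f_1=1)\vee\dots\vee(f_m=1)]$, where $f_1,\dots,f_m$ are group words in the variables $x_0,x_1,\dots$; an equation $u=v$ between words stands for $uv^{-1}=1$. A set $\Delta$ of d-identities is a basis of d-identities of a group $G$ if every member of $\Delta$ holds in $G$ and every group in which all members of $\Delta$ hold satisfies all d-identities of $G$. A section of $G$ is a group isomorphic to a quotient of a subgroup of $G$. Theorem 1. The following five formulas form a basis of d-identities of the alternating group $A_5$: $$\omega_{60}=\bigvee_{0\le i<j\le 60}(x_i=x_j),$$ $$(x^2=1)\vee(x^3=1)\vee(x^5=1),\tag{3.1}$$ $$\Big[\bigvee_{1\le i\le 3}x_i^{15}=1\Big]\vee\Big[\bigvee_{1\le i<j\le 3}(x_ix_j)^{15}=1\Big]\vee\Big[\bigvee_{(i,j,k)\in\{0,1\}^3\setminus\{0\}}x_1^ix_2^jx_3^k=1\Big],\tag{3.2}$$ $$(x_1^{10}=1)\vee(x_2^{10}=1)\vee(x_1=x_2)\vee((x_1x_2)^{10}=1)\vee((x_1^2x_2)^2=1),\tag{3.3}$$ $$(x_1^6=1)\vee(x_2^6=1)\vee((x_1x_2)^6=1)\vee((x_1x_2^2)^6=1)\vee((x_1x_2^3)^6=1)\vee((x_1x_2^4)^6=1).\tag{3.4}$$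 Moreover, every group (finite or infinite) in which all five formulas hold is a section of $A_5$. -/

import Mathlib

universe u v

/-- A disjunctive identity `(f₁ = 1) ∨ ⋯ ∨ (fₙ = 1)`, universally quantified over its variables, is
given by the list of the words `f₁, …, fₙ` in the free group on the variables `x₀, x₁, x₂, …`. An
equation `u = v` between two words is recorded as the word `u * v⁻¹`. The empty disjunction is
false in every group. -/
abbrev DIdentity : Type := List (FreeGroup ℕ)

namespace DIdentity

/-- `δ.HoldsIn G`: the disjunctive identity `δ` is identically true on the group `G`. -/
def HoldsIn (δ : DIdentity) (G : Type*) [Group G] : Prop :=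
  ∀ g : ℕ → G, ∃ f ∈ δ, FreeGroup.lift g f = 1

/-- The variable `xᵢ`. -/
def x (i : ℕ) : FreeGroup ℕ := FreeGroup.of i

/-- `ωₙ`: the disjunction of `xᵢ = xⱼ` over `0 ≤ i < j ≤ n`. -/
def omega (n : ℕ) : DIdentity :=
  (List.range (n + 1)).flatMap fun j => (List.range j).map fun i => x i * (x j)⁻¹

/-- `(x² = 1) ∨ (x³ = 1) ∨ (x⁵ = 1)`. -/
def alpha : DIdentity := [x 1 ^ 2, x 1 ^ 3, x 1 ^ 5]

/-- `⋁ᵢ (xᵢ¹⁵ = 1) ∨ ⋁_{i<j} ((xᵢ xⱼ)¹⁵ = 1) ∨ ⋁ (x₁ⁱ x₂ʲ x₃ᵏ = 1)`, the last disjunction over all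
nonzero vectors `(i, j, k)` with entries in `{0, 1}`. -/
def beta : DIdentity :=
  [x 1 ^ 15, x 2 ^ 15, x 3 ^ 15] ++
  [(x 1 * x 2) ^ 15, (x 1 * x 3) ^ 15, (x 2 * x 3) ^ 15] ++
  [x 1, x 2, x 3, x 1 * x 2, x 1 * x 3, x 2 * x 3, x 1 * x 2 * x 3]

/-- `(x₁¹⁰ = 1) ∨ (x₂¹⁰ = 1) ∨ (x₁ = x₂) ∨ ((x₁ x₂)¹⁰ = 1) ∨ ((x₁² x₂)² = 1)`. -/
def gamma : DIdentity :=
  [x 1 ^ 10, x 2 ^ 10, x 1 * (x 2)⁻¹, (x 1 * x 2) ^ 10, (x 1 ^ 2 * x 2) ^ 2]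

/-- `(x₁⁶ = 1) ∨ (x₂⁶ = 1) ∨ ((x₁ x₂)⁶ = 1) ∨ ((x₁ x₂²)⁶ = 1) ∨ ((x₁ x₂³)⁶ = 1) ∨
((x₁ x₂⁴)⁶ = 1)`. -/
def epsilon : DIdentity :=
  [x 1 ^ 6, x 2 ^ 6, (x 1 * x 2) ^ 6, (x 1 * x 2 ^ 2) ^ 6, (x 1 * x 2 ^ 3) ^ 6,
    (x 1 * x 2 ^ 4) ^ 6]

/-- The five disjunctive identities proposed as a basis for the alternating group of degree 5. -/
def basisA5 : Set DIdentity := {omega 60, alpha, beta, gamma, epsilon}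

end DIdentity

/-- `H` belongs to the d-variety generated by `G`: it satisfies all disjunctive identities of `G`. -/
def MemDVar (H G : Type*) [Group H] [Group G] : Prop :=
  ∀ δ : DIdentity, δ.HoldsIn G → δ.HoldsIn H

/-- `Δ` is a basis of disjunctive identities of `G`: every member of `Δ` holds in `G`, and every
group (in the universe `u`) satisfying all members of `Δ` belongs to the d-variety generated
by `G`. -/
def IsDBasis (Δ : Set DIdentity) (G : Type v) [Group G] : Prop :=
  (∀ δ ∈ Δ, δ.HoldsIn G) ∧
    ∀ (H : Type u) [Group H], (∀ δ ∈ Δ, δ.HoldsIn H) → MemDVar H G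

/-- `H` is a section of `G`: it is isomorphic to a quotient of a subgroup of `G`. -/
def IsSection (H G : Type*) [Group H] [Group G] : Prop :=
  ∃ (K : Subgroup G) (N : Subgroup K) (_ : N.Normal), Nonempty (H ≃* K ⧸ N)

open Equiv Equiv.Perm

/-! ### Disjunctive identities of sections -/

/-! A section of a group inherits all its d-identities, so it is enough that the five formulas hold
in A₅ and that every group satisfying them is a section of A₅. For the first, an element is moved to
a standard permutation by conjugation in S₅ and the rest is a finite check. For the second, let H
satisfy the formulas. `omega` makes H finite, and `alpha` makes every nontrivial element have order
2, 3 or 5, so elements of different prime orders never commute. `beta`, `gamma` and `epsilon` fail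
on C₂³, C₃² and C₅² respectively, whence |H| divides 60 (`card_dvd_sixty`). An element of order p
then acts by conjugation without fixed points on elements of other prime orders. Together with
Burnside transfer this excludes the orders 15, 20 and 30, and leaves one group for each other
divisor: trivial, C₂, C₃, C₅, the dihedral groups of orders 4, 6, 10, A₄ and A₅. All embed in A₅. -/

theorem MemDVar.of_isSection {H : Type*} {G : Type*} [Group H] [Group G] (h : IsSection H G) :
    MemDVar H G := by
  obtain ⟨K, N, hN, ⟨e⟩⟩ := h
  intro δ hδ g
  let π : K →* H := e.symm.toMonoidHom.comp (QuotientGroup.mk' N)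
  have hπ : Function.Surjective π := e.symm.surjective.comp (QuotientGroup.mk'_surjective N)
  choose k hk using fun i => hπ (g i)
  obtain ⟨f, hf, hf1⟩ := hδ fun i => (k i : G)
  refine ⟨f, hf, ?_⟩
  have h1 : K.subtype.comp (FreeGroup.lift k) = FreeGroup.lift fun i => (k i : G) :=
    FreeGroup.ext_hom _ _ fun i => by simp
  have h2 : π.comp (FreeGroup.lift k) = FreeGroup.lift g :=
    FreeGroup.ext_hom _ _ fun i => by simp [hk]
  have h3 : FreeGroup.lift k f = 1 := by
    apply K.subtype_injective
    rw [map_one, ← hf1, ← h1, MonoidHom.comp_apply]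
  rw [← h2, MonoidHom.comp_apply, h3, map_one]

theorem IsSection.of_injective {H : Type*} {G : Type*} [Group H] [Group G] (φ : H →* G)
    (hφ : Function.Injective φ) : IsSection H G :=
  ⟨φ.range, ⊥, inferInstance,
    ⟨(MonoidHom.ofInjective hφ).trans QuotientGroup.quotientBot.symm⟩⟩

theorem IsSection.of_mulEquiv {H H' : Type*} {G : Type*} [Group H] [Group H'] [Group G]
    (e : H ≃* H') (h : IsSection H' G) : IsSection H G := by
  obtain ⟨K, N, hN, ⟨f⟩⟩ := h
  exact ⟨K, N, hN, ⟨e.trans f⟩⟩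

/-! ### The identities as statements about group elements -/

namespace DIdentity

variable {G : Type*} [Group G]

theorem omega_holdsIn_iff (n : ℕ) :
    (omega n).HoldsIn G ↔ ∀ g : ℕ → G, ∃ i j, i < j ∧ j ≤ n ∧ g i = g j := by
  refine forall_congr' fun g => ?_
  simp only [omega, x, List.mem_flatMap, List.mem_range, List.mem_map]
  constructor
  · rintro ⟨f, ⟨j, hj, i, hi, rfl⟩, h⟩
    exact ⟨i, j, hi, by omega, by simpa [mul_inv_eq_one] using h⟩
  · rintro ⟨i, j, hij, hj, h⟩
    exact ⟨_, ⟨j, by omega, i, hij, rfl⟩, by simpa [mul_inv_eq_one] using h⟩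

theorem alpha_holdsIn_iff :
    alpha.HoldsIn G ↔ ∀ a : G, a ^ 2 = 1 ∨ a ^ 3 = 1 ∨ a ^ 5 = 1 := by
  constructor
  · intro h a
    simpa [alpha, x] using h fun _ => a
  · intro h g
    simpa [alpha, x] using h (g 1)

theorem beta_holdsIn_iff :
    beta.HoldsIn G ↔ ∀ a b c : G, a ^ 15 ≠ 1 → b ^ 15 ≠ 1 → c ^ 15 ≠ 1 → (a * b) ^ 15 ≠ 1 →
      (a * c) ^ 15 ≠ 1 → (b * c) ^ 15 ≠ 1 → a = 1 ∨ b = 1 ∨ c = 1 ∨ a * b = 1 ∨ a * c = 1 ∨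
        b * c = 1 ∨ a * b * c = 1 := by
  constructor
  · intro h a b c
    -- Only x₁, x₂, x₃ occur, so the value at other indices is immaterial.
    have := h fun n => if n = 1 then a else if n = 2 then b else c
    simp only [beta, x, List.cons_append, List.nil_append, List.mem_cons, List.not_mem_nil,
      or_false, exists_eq_or_imp, exists_eq_left, map_pow, map_mul, FreeGroup.lift_apply_of] at this
    norm_num at this
    tauto
  · intro h g
    have := h (g 1) (g 2) (g 3)
    simp only [beta, x, List.cons_append, List.nil_append, List.mem_cons, List.not_mem_nil,
      or_false, exists_eq_or_imp, exists_eq_left, map_pow, map_mul, FreeGroup.lift_apply_of]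
    tauto

theorem gamma_holdsIn_iff :
    gamma.HoldsIn G ↔ ∀ a b : G, a ^ 10 ≠ 1 → b ^ 10 ≠ 1 → a ≠ b → (a * b) ^ 10 ≠ 1 →
      (a ^ 2 * b) ^ 2 = 1 := by
  constructor
  · intro h a b
    have := h fun n => if n = 1 then a else b
    simp only [gamma, x, List.mem_cons, List.not_mem_nil, mul_inv_eq_one, map_inv,
      or_false, exists_eq_or_imp, exists_eq_left, map_pow, map_mul, FreeGroup.lift_apply_of] at this
    norm_num at this
    tauto
  · intro h g
    have := h (g 1) (g 2)
    simp only [gamma, x, List.mem_cons, List.not_mem_nil, mul_inv_eq_one, map_inv,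
      or_false, exists_eq_or_imp, exists_eq_left, map_pow, map_mul, FreeGroup.lift_apply_of]
    tauto

theorem epsilon_holdsIn_iff :
    epsilon.HoldsIn G ↔ ∀ a b : G, a ^ 6 ≠ 1 → b ^ 6 ≠ 1 → (a * b) ^ 6 ≠ 1 →
      (a * b ^ 2) ^ 6 ≠ 1 → (a * b ^ 3) ^ 6 ≠ 1 → (a * b ^ 4) ^ 6 = 1 := by
  constructor
  · intro h a b
    have := h fun n => if n = 1 then a else b
    simp only [epsilon, x, List.mem_cons, List.not_mem_nil,
      or_false, exists_eq_or_imp, exists_eq_left, map_pow, map_mul, FreeGroup.lift_apply_of] at this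
    norm_num at this
    tauto
  · intro h g
    have := h (g 1) (g 2)
    simp only [epsilon, x, List.mem_cons, List.not_mem_nil,
      or_false, exists_eq_or_imp, exists_eq_left, map_pow, map_mul, FreeGroup.lift_apply_of]
    tauto

end DIdentity

/-! ### The identities hold in the alternating group of degree five -/

namespace alternatingGroupFive

theorem nat_card : Nat.card (alternatingGroup (Fin 5)) = 60 := by
  rw [nat_card_alternatingGroup, Nat.card_eq_fintype_card, Fintype.card_fin]
  rfl

theorem pow_eq_one (a : alternatingGroup (Fin 5)) : a ^ 2 = 1 ∨ a ^ 3 = 1 ∨ a ^ 5 = 1 := by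
  revert a
  decide +kernel

/-- Evenness rules out a single transposition. Conjugacy is taken in S₅, which suffices for checking
words and, unlike A₅, has a single class of 5-cycles. -/
theorem isConj_of_sq_eq_one {σ : Perm (Fin 5)} (hs : sign σ = 1) (h1 : σ ≠ 1) (h : σ ^ 2 = 1) :
    IsConj (c[0, 1] * c[2, 3]) σ := by
  have ho : orderOf σ = 2 := orderOf_eq_prime h h1
  obtain ⟨n, hn⟩ := cycleType_prime_order (ho ▸ Nat.prime_two)
  have hsum := sum_cycleType_le σ
  rw [sign_of_cycleType, hn, ho] at hs
  rw [hn, ho] at hsum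
  simp at hsum
  have : n = 0 ∨ n = 1 := by omega
  rw [isConj_iff_cycleType_eq, hn, ho]
  rcases this with rfl | rfl
  · revert hs; decide
  · decide +kernel

theorem isConj_of_pow_three_eq_one {σ : Perm (Fin 5)} (h1 : σ ≠ 1) (h : σ ^ 3 = 1) :
    IsConj c[0, 1, 2] σ := by
  have ho : orderOf σ = 3 := orderOf_eq_prime h h1
  obtain ⟨n, hn⟩ := cycleType_prime_order (ho ▸ Nat.prime_three)
  have hsum := sum_cycleType_le σ
  rw [hn, ho] at hsum
  simp at hsum
  obtain rfl : n = 0 := by omega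
  rw [isConj_iff_cycleType_eq, hn, ho]
  decide +kernel

theorem isConj_of_pow_five_eq_one {σ : Perm (Fin 5)} (h1 : σ ≠ 1) (h : σ ^ 5 = 1) :
    IsConj c[0, 1, 2, 3, 4] σ := by
  have : Fact (Nat.Prime 5) := ⟨Nat.prime_five⟩
  have ho : orderOf σ = 5 := orderOf_eq_prime h h1
  obtain ⟨n, hn⟩ := cycleType_prime_order (ho ▸ Nat.prime_five)
  have hsum := sum_cycleType_le σ
  rw [hn, ho] at hsum
  simp at hsum
  obtain rfl : n = 0 := by omega
  rw [isConj_iff_cycleType_eq, hn, ho]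
  decide +kernel

/-- The hypotheses make τ commute with the double transposition, whose centralizer in A₅ is the
Klein four-group. -/
theorem klein_computation : ∀ τ : Perm (Fin 5), sign τ = 1 ∧ τ ^ 2 = 1 ∧
    ((c[0, 1] * c[2, 3]) * τ) ^ 2 = 1 → τ = 1 ∨ τ = c[0, 1] * c[2, 3] ∨ τ = c[0, 2] * c[1, 3] ∨
      τ = c[0, 3] * c[1, 2] := by
  decide +kernel

/-- Such a pair generates a copy of A₄ and lies in one coset of its Klein subgroup V, so σ²τ = σ⁻¹τ
falls in V. -/
theorem three_computation : ∀ τ : Perm (Fin 5), τ ^ 3 = 1 ∧ τ ≠ 1 ∧ c[0, 1, 2] ≠ τ ∧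
    (c[0, 1, 2] * τ) ^ 3 = 1 ∧ c[0, 1, 2] * τ ≠ 1 → (c[0, 1, 2] ^ 2 * τ) ^ 2 = 1 := by
  decide +kernel

/-- If σ is not a power of τ, the coset σ⟨τ⟩ contains an element whose order is not 5. -/
theorem five_computation : ∀ τ : Perm (Fin 5), τ ^ 5 = 1 ∧ τ ≠ 1 ∧
    (c[0, 1, 2, 3, 4] * τ) ^ 5 = 1 ∧ (c[0, 1, 2, 3, 4] * τ ^ 2) ^ 5 = 1 ∧
    (c[0, 1, 2, 3, 4] * τ ^ 3) ^ 5 = 1 ∧ (c[0, 1, 2, 3, 4] * τ ^ 4) ^ 5 = 1 →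
    c[0, 1, 2, 3, 4] * τ = 1 ∨ c[0, 1, 2, 3, 4] * τ ^ 2 = 1 ∨ c[0, 1, 2, 3, 4] * τ ^ 3 = 1 ∨
      c[0, 1, 2, 3, 4] * τ ^ 4 = 1 := by
  decide +kernel

/-- When all orders are 1, 2, 3 or 5, the exponents 15, 10 and 6 single out one prime: the
inequations a¹⁵ ≠ 1, a¹⁰ ≠ 1, a⁶ ≠ 1 mean order 2, 3, 5. -/
theorem sq_eq_one_of_pow_ne_one {G : Type*} [Group G]
    (h : ∀ a : G, a ^ 2 = 1 ∨ a ^ 3 = 1 ∨ a ^ 5 = 1) {a : G} (ha : a ^ 15 ≠ 1) : a ^ 2 = 1 := by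
  rcases h a with h | h | h
  · exact h
  · exact absurd (by rw [show 15 = 3 * 5 from rfl, pow_mul, h, one_pow]) ha
  · exact absurd (by rw [show 15 = 5 * 3 from rfl, pow_mul, h, one_pow]) ha

theorem pow_three_eq_one_of_pow_ne_one {G : Type*} [Group G]
    (h : ∀ a : G, a ^ 2 = 1 ∨ a ^ 3 = 1 ∨ a ^ 5 = 1) {a : G} (ha : a ^ 10 ≠ 1) : a ^ 3 = 1 := by
  rcases h a with h | h | h
  · exact absurd (by rw [show 10 = 2 * 5 from rfl, pow_mul, h, one_pow]) ha
  · exact h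
  · exact absurd (by rw [show 10 = 5 * 2 from rfl, pow_mul, h, one_pow]) ha

theorem pow_five_eq_one_of_pow_ne_one {G : Type*} [Group G]
    (h : ∀ a : G, a ^ 2 = 1 ∨ a ^ 3 = 1 ∨ a ^ 5 = 1) {a : G} (ha : a ^ 6 ≠ 1) : a ^ 5 = 1 := by
  rcases h a with h | h | h
  · exact absurd (by rw [show 6 = 2 * 3 from rfl, pow_mul, h, one_pow]) ha
  · exact absurd (by rw [show 6 = 3 * 2 from rfl, pow_mul, h, one_pow]) ha
  · exact h

theorem ne_one_of_pow_ne_one {G : Type*} [Group G] {a : G} {n : ℕ} (ha : a ^ n ≠ 1) : a ≠ 1 := by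
  rintro rfl
  exact ha (one_pow n)

theorem omega_holdsIn : (DIdentity.omega 60).HoldsIn (alternatingGroup (Fin 5)) := by
  rw [DIdentity.omega_holdsIn_iff]
  intro g
  have hcard : Fintype.card (alternatingGroup (Fin 5)) < Fintype.card (Fin 61) := by
    rw [← Nat.card_eq_fintype_card, nat_card, Fintype.card_fin]
    norm_num
  obtain ⟨i, j, hij, h⟩ := Fintype.exists_ne_map_eq_of_card_lt (fun i : Fin 61 => g i) hcard
  rcases lt_or_gt_of_ne hij with hlt | hlt
  · exact ⟨i, j, hlt, by omega, h⟩
  · exact ⟨j, i, hlt, by omega, h.symm⟩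

theorem beta_holdsIn : DIdentity.beta.HoldsIn (alternatingGroup (Fin 5)) := by
  rw [DIdentity.beta_holdsIn_iff]
  intro a b c ha hb hc hab hac _
  have hb1 := ne_one_of_pow_ne_one hb
  have hc1 := ne_one_of_pow_ne_one hc
  have ha1 := ne_one_of_pow_ne_one ha
  replace ha := sq_eq_one_of_pow_ne_one pow_eq_one ha
  replace hb := sq_eq_one_of_pow_ne_one pow_eq_one hb
  replace hc := sq_eq_one_of_pow_ne_one pow_eq_one hc
  replace hab := sq_eq_one_of_pow_ne_one pow_eq_one hab
  replace hac := sq_eq_one_of_pow_ne_one pow_eq_one hac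
  obtain ⟨a, has⟩ := a
  obtain ⟨b, hbs⟩ := b
  obtain ⟨c, hcs⟩ := c
  simp only [Subtype.ext_iff, ne_eq, Subgroup.coe_mul, Subgroup.coe_pow, Subgroup.coe_one] at *
  rw [mem_alternatingGroup] at has hbs hcs
  obtain ⟨g, rfl⟩ := isConj_iff.1 (isConj_of_sq_eq_one has ha1 ha)
  obtain ⟨b, rfl⟩ := (MulAut.conj g).surjective b
  obtain ⟨c, rfl⟩ := (MulAut.conj g).surjective c
  rw [← MulAut.conj_apply] at *
  simp only [← map_mul, ← map_pow, EmbeddingLike.map_eq_one_iff] at *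
  simp only [MulAut.conj_apply, map_mul, map_inv, mul_inv_cancel_comm] at hbs hcs
  have key : ∀ d : Perm (Fin 5), sign d = 1 → ¬ d = 1 → d ^ 2 = 1 →
      ((c[0, 1] * c[2, 3]) * d) ^ 2 = 1 → d = c[0, 1] * c[2, 3] ∨ d = c[0, 2] * c[1, 3] ∨
      d = c[0, 3] * c[1, 2] := fun d hs h1 h2 h3 =>
    (klein_computation d ⟨hs, h2, h3⟩).resolve_left h1
  -- b and c are nontrivial elements of the Klein group containing a: either two of the three
  -- coincide, with product 1, or abc = 1.
  rcases key b hbs hb1 hb hab with rfl | rfl | rfl <;>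
  rcases key c hcs hc1 hc hac with rfl | rfl | rfl <;> decide +kernel

theorem gamma_holdsIn : DIdentity.gamma.HoldsIn (alternatingGroup (Fin 5)) := by
  rw [DIdentity.gamma_holdsIn_iff]
  intro a b ha hb hne hab
  have ha1 := ne_one_of_pow_ne_one ha
  have hb1 := ne_one_of_pow_ne_one hb
  have hab1 := ne_one_of_pow_ne_one hab
  replace ha := pow_three_eq_one_of_pow_ne_one pow_eq_one ha
  replace hb := pow_three_eq_one_of_pow_ne_one pow_eq_one hb
  replace hab := pow_three_eq_one_of_pow_ne_one pow_eq_one hab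
  obtain ⟨a, _⟩ := a
  obtain ⟨b, _⟩ := b
  simp only [Subtype.ext_iff, ne_eq, Subgroup.coe_mul, Subgroup.coe_pow, Subgroup.coe_one] at *
  obtain ⟨g, rfl⟩ := isConj_iff.1 (isConj_of_pow_three_eq_one ha1 ha)
  obtain ⟨b, rfl⟩ := (MulAut.conj g).surjective b
  rw [← MulAut.conj_apply] at *
  simp only [← map_mul, ← map_pow, EmbeddingLike.map_eq_one_iff, EmbeddingLike.apply_eq_iff_eq] at *
  exact three_computation b ⟨hb, hb1, hne, hab, hab1⟩

theorem epsilon_holdsIn : DIdentity.epsilon.HoldsIn (alternatingGroup (Fin 5)) := by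
  rw [DIdentity.epsilon_holdsIn_iff]
  intro a b ha hb h1 h2 h3
  by_contra h4
  have ha' := ne_one_of_pow_ne_one ha
  have hb' := ne_one_of_pow_ne_one hb
  have h1' := ne_one_of_pow_ne_one h1
  have h2' := ne_one_of_pow_ne_one h2
  have h3' := ne_one_of_pow_ne_one h3
  have h4' := ne_one_of_pow_ne_one h4
  replace ha := pow_five_eq_one_of_pow_ne_one pow_eq_one ha
  replace hb := pow_five_eq_one_of_pow_ne_one pow_eq_one hb
  replace h1 := pow_five_eq_one_of_pow_ne_one pow_eq_one h1
  replace h2 := pow_five_eq_one_of_pow_ne_one pow_eq_one h2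
  replace h3 := pow_five_eq_one_of_pow_ne_one pow_eq_one h3
  replace h4 := pow_five_eq_one_of_pow_ne_one pow_eq_one h4
  obtain ⟨a, _⟩ := a
  obtain ⟨b, _⟩ := b
  simp only [Subtype.ext_iff, ne_eq, Subgroup.coe_mul, Subgroup.coe_pow, Subgroup.coe_one] at *
  obtain ⟨g, rfl⟩ := isConj_iff.1 (isConj_of_pow_five_eq_one ha' ha)
  obtain ⟨b, rfl⟩ := (MulAut.conj g).surjective b
  rw [← MulAut.conj_apply] at *
  simp only [← map_mul, ← map_pow, EmbeddingLike.map_eq_one_iff] at *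
  rcases five_computation b ⟨hb, hb', h1, h2, h3, h4⟩ with h | h | h | h
  exacts [h1' h, h2' h, h3' h, h4' h]

theorem basis_holdsIn : ∀ δ ∈ DIdentity.basisA5, δ.HoldsIn (alternatingGroup (Fin 5)) := by
  rintro δ (rfl | rfl | rfl | rfl | rfl)
  · exact omega_holdsIn
  · exact DIdentity.alpha_holdsIn_iff.2 pow_eq_one
  · exact beta_holdsIn
  · exact gamma_holdsIn
  · exact epsilon_holdsIn

end alternatingGroupFive

/-! ### Finite groups in which every nontrivial element has prime order -/

/-- Every nontrivial element has prime order. -/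
def HasPrimeOrders (G : Type*) [Group G] : Prop :=
  ∀ a : G, a ≠ 1 → (orderOf a).Prime

namespace HasPrimeOrders

variable {G : Type*} [Group G]

theorem of_pow_eq_one (h : ∀ a : G, a ^ 2 = 1 ∨ a ^ 3 = 1 ∨ a ^ 5 = 1) : HasPrimeOrders G := by
  have : Fact (Nat.Prime 5) := ⟨Nat.prime_five⟩
  intro a ha
  rcases h a with h | h | h
  · exact orderOf_eq_prime h ha ▸ Nat.prime_two
  · exact orderOf_eq_prime h ha ▸ Nat.prime_three
  · exact orderOf_eq_prime h ha ▸ Nat.prime_five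

theorem subgroup (hG : HasPrimeOrders G) (K : Subgroup G) : HasPrimeOrders K := by
  intro a ha
  rw [← Subgroup.orderOf_coe]
  exact hG a (by simpa using ha)

theorem not_commute (hG : HasPrimeOrders G) {a b : G} (ha : a ≠ 1) (hb : b ≠ 1)
    (hab : orderOf a ≠ orderOf b) : ¬ Commute a b := by
  intro h
  have hpa := hG a ha
  have hpb := hG b hb
  have ho := h.orderOf_mul_eq_mul_orderOf_of_coprime ((Nat.coprime_primes hpa hpb).2 hab)
  have h1 : a * b ≠ 1 := by
    intro h1
    rw [h1, orderOf_one] at ho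
    exact hpa.one_lt.ne' (Nat.eq_one_of_mul_eq_one_right ho.symm)
  exact Nat.not_prime_mul hpa.one_lt.ne' hpb.one_lt.ne' (ho ▸ hG _ h1)

theorem pow_eq_one_of_pow_pow_eq_one (hG : HasPrimeOrders G) {p n : ℕ} (hp : p.Prime) {a : G}
    (h : a ^ p ^ n = 1) : a ^ p = 1 := by
  by_cases ha : a = 1
  · rw [ha, one_pow]
  · have := (Nat.prime_dvd_prime_iff_eq (hG a ha) hp).1
      ((hG a ha).dvd_of_dvd_pow (orderOf_dvd_of_pow_eq_one h))
    rw [← this, pow_orderOf_eq_one]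

/-- A subgroup of order p² is abelian, and here of exponent p, so it is C_p × C_p. -/
theorem exists_commute_of_sq_dvd_card [Finite G] (hG : HasPrimeOrders G) (p : ℕ)
    [hp : Fact p.Prime] (h : p ^ 2 ∣ Nat.card G) :
    ∃ a b : G, a ^ p = 1 ∧ a ≠ 1 ∧ b ^ p = 1 ∧ b ∉ Subgroup.zpowers a ∧ Commute a b := by
  obtain ⟨K, hK⟩ := Sylow.exists_subgroup_card_pow_prime p h
  have hpow : ∀ a : K, (a : G) ^ p = 1 := by
    intro a
    refine hG.pow_eq_one_of_pow_pow_eq_one hp.out (n := 2) ?_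
    rw [← Subgroup.coe_pow, ← hK, pow_card_eq_one', Subgroup.coe_one]
  have hlt : 1 < Nat.card K := hK ▸ Nat.one_lt_pow two_ne_zero hp.out.one_lt
  have : Nontrivial K := Finite.one_lt_card_iff_nontrivial.1 hlt
  obtain ⟨a, ha⟩ := exists_ne (1 : K)
  have hapow : a ^ p = 1 := Subtype.ext (by simpa using hpow a)
  have hne : Subgroup.zpowers a ≠ ⊤ := by
    intro ht
    have h1 : Nat.card (Subgroup.zpowers a) = p := by
      rw [Nat.card_zpowers, orderOf_eq_prime hapow ha]
    rw [ht, Subgroup.card_top, hK] at h1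
    exact (Nat.pow_lt_pow_right hp.out.one_lt one_lt_two).ne' (by rw [h1, pow_one])
  obtain ⟨b, hb⟩ := SetLike.exists_not_mem_of_ne_top _ hne rfl
  refine ⟨a, b, hpow a, by simpa using ha, hpow b, ?_, ?_⟩
  · rintro ⟨n, hn⟩
    exact hb ⟨n, Subtype.ext (by simpa using hn)⟩
  · have := (IsPGroup.isMulCommutative_of_card_eq_prime_sq hK).is_comm.comm a b
    exact congrArg Subtype.val this

end HasPrimeOrders

/-! ### Conjugation by elements of prime order -/

section Conj

variable {G : Type*} [Group G]

/-- The orbits of ⟨g⟩ on S have length 1 or p, and a fixed point would commute with g. -/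
theorem dvd_ncard_of_conj_mem [Finite G] {g : G} {p : ℕ} [Fact p.Prime] (hg : g ^ p = 1)
    {S : Set G} (hS : ∀ s ∈ S, g * s * g⁻¹ ∈ S) (hfree : ∀ s ∈ S, ¬ Commute g s) :
    p ∣ S.ncard := by
  classical
  have : Fintype S := Fintype.ofFinite S
  let f : Function.End S := fun s => ⟨g * s * g⁻¹, hS s s.2⟩
  have hf : ∀ (n : ℕ) (s : S), ((f ^ n) s : G) = g ^ n * s * (g ^ n)⁻¹ := by
    intro n
    induction n with
    | zero =>
      intro s
      rw [pow_zero, pow_zero, one_mul, inv_one, mul_one]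
      rfl
    | succ n ih =>
      intro s
      rw [pow_succ, pow_succ, mul_inv_rev]
      refine (ih (f s)).trans ?_
      simp only [f, mul_assoc]
  have h1 : f ^ p ^ 1 = 1 := by
    funext s
    apply Subtype.ext
    rw [hf, pow_one, hg, one_mul, inv_one, mul_one]
    rfl
  have hmod := Equiv.Perm.card_fixedPoints_modEq h1
  have h0 : Fintype.card (Function.fixedPoints f) = 0 := by
    rw [Fintype.card_eq_zero_iff]
    refine ⟨fun s => hfree s.1 s.1.2 ?_⟩
    have := congrArg Subtype.val s.2
    exact mul_inv_eq_iff_eq_mul.1 this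
  rw [h0] at hmod
  rw [← Nat.card_coe_set_eq, Nat.card_eq_fintype_card]
  exact (Nat.modEq_zero_iff_dvd).1 hmod

/-- As K is abelian, (sas⁻¹)a is fixed by the involution s. It lies in a group of odd order, so if
nontrivial it could not commute with s. -/
theorem conj_eq_inv_of_odd (hG : HasPrimeOrders G) {K : Subgroup G}
    (hcomm : IsMulCommutative K) (hodd : Odd (Nat.card K)) {s : G} (hs : s ^ 2 = 1) (hs1 : s ≠ 1)
    (hK : ∀ k ∈ K, s * k * s⁻¹ ∈ K) {a : G} (ha : a ∈ K) : s * a * s⁻¹ = a⁻¹ := by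
  have hinv : s⁻¹ = s := inv_eq_of_mul_eq_one_left (by rw [← sq, hs])
  have hss : s * s = 1 := by rw [← sq, hs]
  have hc : s * a * s⁻¹ * a = a * (s * a * s⁻¹) :=
    congrArg Subtype.val (hcomm.is_comm.comm ⟨_, hK a ha⟩ ⟨a, ha⟩)
  rw [eq_inv_iff_mul_eq_one]
  by_contra hne
  refine hG.not_commute hs1 hne ?_ ?_
  · rw [orderOf_eq_prime hs hs1]
    intro h2
    have hmem : s * a * s⁻¹ * a ∈ K := K.mul_mem (hK a ha) ha
    have h3 : 2 ∣ Nat.card K := by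
      rw [h2, Subgroup.orderOf_mk _ hmem |>.symm]
      exact orderOf_dvd_natCard _
    exact (Nat.not_even_iff_odd.2 hodd) (even_iff_two_dvd.2 h3)
  · rw [hinv] at hc ⊢
    calc s * (s * a * s * a) = s * s * (a * s * a) := by simp only [mul_assoc]
      _ = a * (s * a * s) * s := by simp only [hss, one_mul, mul_assoc, mul_one]
      _ = s * a * s * a * s := by rw [← hc]

/-- Both s and t invert K, so the involution st centralizes the odd-order group K. -/
theorem false_of_klein_normalizes (hG : HasPrimeOrders G) {K : Subgroup G}
    (hcomm : IsMulCommutative K) (hodd : Odd (Nat.card K)) (hK1 : K ≠ ⊥) {s t : G}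
    (hs : s ^ 2 = 1) (hs1 : s ≠ 1) (ht : t ^ 2 = 1) (ht1 : t ≠ 1) (hst : s ≠ t)
    (hc : Commute s t) (hK : K.Normal) : False := by
  obtain ⟨a, ha, ha1⟩ := K.bot_or_exists_ne_one.resolve_left hK1
  have h1 := conj_eq_inv_of_odd hG hcomm hodd hs hs1 (fun k hk => hK.conj_mem k hk s) ha
  have h2 := conj_eq_inv_of_odd hG hcomm hodd ht ht1 (fun k hk => hK.conj_mem k hk t)
    (K.inv_mem ha)
  have hst1 : s * t ≠ 1 := fun h => hst <| by
    rw [eq_inv_of_mul_eq_one_left h, inv_eq_of_mul_eq_one_left (by rw [← sq, ht])]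
  have hst2 : (s * t) ^ 2 = 1 := by rw [hc.mul_pow, hs, ht, one_mul]
  refine hG.not_commute hst1 ha1 ?_ ?_
  · rw [orderOf_eq_prime hst2 hst1]
    intro h2
    have h3 : 2 ∣ Nat.card K := by
      rw [h2, Subgroup.orderOf_mk _ ha |>.symm]
      exact orderOf_dvd_natCard _
    exact (Nat.not_even_iff_odd.2 hodd) (even_iff_two_dvd.2 h3)
  · rw [inv_inv] at h2
    rw [hc.eq]
    apply mul_inv_eq_iff_eq_mul.1
    rw [mul_inv_rev]
    calc t * s * a * (s⁻¹ * t⁻¹) = t * (s * a * s⁻¹) * t⁻¹ := by group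
      _ = a := by rw [h1, h2]

end Conj

/-! ### Dihedral groups -/

theorem exists_injective_dihedralGroup {G : Type*} [Group G] {n : ℕ} {a b : G}
    (ha : orderOf a = n) (hb : b * b = 1) (hab : b * a * b⁻¹ = a⁻¹)
    (hb' : b ∉ Subgroup.zpowers a) :
    ∃ φ : DihedralGroup n →* G, Function.Injective φ := by
  let f : ZMod n →+ Additive G :=
    ZMod.lift n ⟨zmultiplesHom (Additive G) (Additive.ofMul a), by
      simp [← ofMul_pow, ← ha, pow_orderOf_eq_one]⟩
  let F : ZMod n → G := fun i => (f i).toMul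
  have hFint : ∀ i : ℤ, F i = a ^ i := fun i => by simp [F, f]
  have hadd : ∀ i j, F (i + j) = F i * F j := fun i j => by simp [F]
  have hneg : ∀ i, F (-i) = (F i)⁻¹ := fun i => by simp [F]
  have h0 : F 0 = 1 := by simp [F]
  have hconj : ∀ i, F i * b = b * F (-i) := by
    intro i
    obtain ⟨k, rfl⟩ := ZMod.intCast_surjective i
    have : b * a ^ k * b⁻¹ = (a ^ k)⁻¹ := by rw [← conj_zpow, hab, inv_zpow]
    rw [hneg, hFint, ← this]
    have hbi : b⁻¹ = b := inv_eq_of_mul_eq_one_left hb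
    rw [hbi, ← mul_assoc, ← mul_assoc, hb, one_mul]
  let φ : DihedralGroup n →* G :=
    { toFun := fun d => match d with
        | .r i => F i
        | .sr i => b * F i
      map_one' := h0
      map_mul' := by
        rintro (i | i) (j | j)
        · simp only [DihedralGroup.r_mul_r, hadd]
        · simp only [DihedralGroup.r_mul_sr]
          rw [← mul_assoc, hconj, mul_assoc, ← hadd, neg_add_eq_sub]
        · simp only [DihedralGroup.sr_mul_r, hadd, mul_assoc]
        · simp only [DihedralGroup.sr_mul_sr]
          rw [mul_assoc, ← mul_assoc (F i), hconj, mul_assoc, ← hadd, ← mul_assoc, hb, one_mul,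
            neg_add_eq_sub] }
  refine ⟨φ, (injective_iff_map_eq_one φ).2 ?_⟩
  rintro (i | i) h
  · obtain ⟨k, rfl⟩ := ZMod.intCast_surjective i
    have h1 : F k = 1 := h
    rw [hFint, ← orderOf_dvd_iff_zpow_eq_one, ha] at h1
    rw [(ZMod.intCast_zmod_eq_zero_iff_dvd _ _).2 h1, DihedralGroup.r_zero]
  · obtain ⟨k, rfl⟩ := ZMod.intCast_surjective i
    have h1 : b * F k = 1 := h
    rw [hFint] at h1
    exact absurd ⟨-k, (zpow_neg a k).trans (eq_inv_of_mul_eq_one_left h1).symm⟩ hb'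

theorem nonempty_mulEquiv_dihedralGroup {G : Type*} [Group G] [Finite G] {n : ℕ} {a b : G}
    (ha : orderOf a = n) (hb : b * b = 1) (hab : b * a * b⁻¹ = a⁻¹)
    (hb' : b ∉ Subgroup.zpowers a) (hcard : Nat.card G = 2 * n) :
    Nonempty (G ≃* DihedralGroup n) := by
  obtain ⟨φ, hφ⟩ := exists_injective_dihedralGroup ha hb hab hb'
  have : Finite (DihedralGroup n) := Finite.of_injective φ hφ
  have := (Nat.bijective_iff_injective_and_card φ).2 ⟨hφ, by rw [hcard, DihedralGroup.nat_card]⟩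
  exact ⟨(MulEquiv.ofBijective φ this).symm⟩

/-! ### Actions on cosets -/

/-- The action on cosets of N is faithful, and its image has index 2 in the symmetric group, where
only the alternating group has that index. -/
theorem nonempty_mulEquiv_alternatingGroup {G : Type*} [Group G] [Finite G] (N : Subgroup G)
    {n : ℕ} (hn : N.index = n) (hcore : N.normalCore = ⊥) (hcard : Nat.card G * 2 = n.factorial) :
    Nonempty (G ≃* alternatingGroup (Fin n)) := by
  classical
  have : Fintype (G ⧸ N) := Fintype.ofFinite _
  let φ := MulAction.toPermHom G (G ⧸ N)
  have hφ : Function.Injective φ := by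
    rw [← MonoidHom.ker_eq_bot_iff, ← Subgroup.normalCore_eq_ker, hcore]
  have hNn : Nat.card (G ⧸ N) = n := hn
  have hr : Nat.card φ.range = Nat.card G := (Nat.card_congr (MonoidHom.ofInjective hφ).toEquiv).symm
  have hi : φ.range.index = 2 := by
    have h := φ.range.card_mul_index
    rw [hr, Nat.card_perm, hNn, ← hcard] at h
    exact Nat.eq_of_mul_eq_mul_left Nat.card_pos h
  have e1 : G ≃* alternatingGroup (G ⧸ N) :=
    (MonoidHom.ofInjective hφ).trans
      (MulEquiv.subgroupCongr (eq_alternatingGroup_of_index_eq_two hi))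
  exact ⟨e1.trans (Equiv.altCongrHom (Finite.equivFinOfCardEq hNn))⟩

/-! ### Normal complements and excluded orders -/

section Orders

variable {G : Type*} [Group G] [Finite G]

theorem Sylow.card_eq_of_card_eq_pow_mul {p k m : ℕ} [hp : Fact p.Prime] (P : Sylow p G)
    (hcard : Nat.card G = p ^ k * m) (hm : ¬ p ∣ m) : Nat.card P = p ^ k := by
  have hm0 : m ≠ 0 := fun h => hm (h ▸ dvd_zero p)
  rw [P.card_eq_multiplicity, hcard, Nat.factorization_mul (pow_ne_zero _ hp.out.ne_zero) hm0,
    Finsupp.add_apply, hp.out.factorization_pow, Finsupp.single_eq_same,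
    Nat.factorization_eq_zero_of_not_dvd hm, add_zero]

/-- Burnside: a cyclic Sylow subgroup for the smallest prime divisor has a normal complement, the
kernel of the transfer. -/
theorem exists_normal_of_minFac {p m : ℕ} [hp : Fact p.Prime] (hcard : Nat.card G = p * m)
    (hm : ¬ p ∣ m) (hmin : (Nat.card G).minFac = p) :
    ∃ K : Subgroup G, K.Normal ∧ Nat.card K = m := by
  obtain ⟨P⟩ : Nonempty (Sylow p G) := inferInstance
  have hP : Nat.card P = p := by
    rw [P.card_eq_of_card_eq_pow_mul (k := 1) (by rw [hcard, pow_one]) hm, pow_one]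
  have hcyc : IsCyclic P := isCyclic_of_prime_card hP
  refine ⟨(MonoidHom.transferSylow P (IsCyclic.normalizer_le_centralizer hmin hcyc)).ker,
    inferInstance, ?_⟩
  have h := (IsCyclic.isComplement' hmin hcyc).card_mul_card
  rw [hcard, mul_comm p, show Nat.card (P : Subgroup G) = p from hP] at h
  exact Nat.eq_of_mul_eq_mul_right hp.out.pos h

theorem HasPrimeOrders.dvd_card_sub_one (hG : HasPrimeOrders G) {g : G} {p : ℕ} [hp : Fact p.Prime]
    (hg : orderOf g = p) (K : Subgroup G) (hK : ∀ k ∈ K, g * k * g⁻¹ ∈ K)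
    (hpK : ¬ p ∣ Nat.card K) : p ∣ Nat.card K - 1 := by
  have hg1 : g ≠ 1 := by
    rintro rfl
    exact hp.out.one_lt.ne (by simpa using hg)
  have hc : ((K : Set G) \ {1}).ncard = Nat.card K - 1 := by
    rw [Set.ncard_sdiff_singleton_of_mem K.one_mem]
    rfl
  rw [← hc]
  refine dvd_ncard_of_conj_mem (hg ▸ pow_orderOf_eq_one g) ?_ ?_
  · rintro s ⟨hs, hs1⟩
    exact ⟨hK s hs, by simpa using hs1⟩
  · rintro s ⟨hs, hs1⟩
    refine hG.not_commute hg1 hs1 fun h => hpK ?_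
    rw [← hg, h]
    exact Subgroup.orderOf_dvd_natCard K hs

theorem HasPrimeOrders.dvd_ncard_orderOf_eq (hG : HasPrimeOrders G) {g : G} {p q : ℕ}
    [hp : Fact p.Prime] [hq : Fact q.Prime] (hpq : p ≠ q) (hg : orderOf g = p) (K : Subgroup G)
    (hK : ∀ k ∈ K, g * k * g⁻¹ ∈ K) : p ∣ {k | k ∈ K ∧ orderOf k = q}.ncard := by
  have hne : ∀ {a : G} {r : ℕ} [Fact r.Prime], orderOf a = r → a ≠ 1 := by
    rintro _ r hr h rfl
    exact hr.out.one_lt.ne (by simpa using h)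
  refine dvd_ncard_of_conj_mem (hg ▸ pow_orderOf_eq_one g) ?_ ?_
  · rintro s ⟨hs, hsq⟩
    refine ⟨hK s hs, ?_⟩
    rw [← hsq]
    exact orderOf_injective (MulAut.conj g).toMonoidHom (MulAut.conj g).injective s
  · rintro s ⟨hs, hsq⟩
    exact hG.not_commute (hne hg) (hne hsq) (by rw [hg, hsq]; exact hpq)

/-- An element of order 3 would act freely on the 4 nontrivial elements of a normal subgroup of
order 5. -/
theorem HasPrimeOrders.card_ne_fifteen (hG : HasPrimeOrders G) : Nat.card G ≠ 15 := by
  intro h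
  obtain ⟨K, hK, hKc⟩ := exists_normal_of_minFac (G := G) (p := 3) (m := 5) (by rw [h])
    (by norm_num) (by rw [h]; norm_num)
  obtain ⟨g, hg⟩ := exists_prime_orderOf_dvd_card' (G := G) 3 (by rw [h]; norm_num)
  have := hG.dvd_card_sub_one hg K (fun k hk => hK.conj_mem k hk g) (by rw [hKc]; norm_num)
  rw [hKc] at this
  norm_num at this

theorem HasPrimeOrders.card_ne_thirty (hG : HasPrimeOrders G) : Nat.card G ≠ 30 := by
  intro h
  obtain ⟨K, -, hKc⟩ := exists_normal_of_minFac (G := G) (p := 2) (m := 15) (by rw [h])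
    (by norm_num) (by rw [h]; norm_num)
  exact (hG.subgroup K).card_ne_fifteen hKc

theorem HasPrimeOrders.eq_bot_of_normal_of_isMulCommutative (hG : HasPrimeOrders G)
    (h4 : 4 ∣ Nat.card G) {K : Subgroup G} (hK : K.Normal) (hcomm : IsMulCommutative K)
    (hodd : Odd (Nat.card K)) : K = ⊥ := by
  by_contra hne
  obtain ⟨s, t, hs, hs1, ht, hts, hc⟩ := hG.exists_commute_of_sq_dvd_card 2 h4
  refine false_of_klein_normalizes hG hcomm hodd hne hs hs1 ht ?_ ?_ hc hK
  · rintro rfl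
    exact hts (Subgroup.one_mem _)
  · rintro rfl
    exact hts (Subgroup.mem_zpowers s)

theorem HasPrimeOrders.card_normalizer_sylow_two (hG : HasPrimeOrders G) {m : ℕ}
    (hcard : Nat.card G = 4 * m) (hm : m = 3 ∨ m = 5 ∨ m = 15) (P : Sylow 2 G) :
    Nat.card (Subgroup.normalizer (P : Set G)) = 12 := by
  have : Fact (Nat.Prime 5) := ⟨Nat.prime_five⟩
  have hm2 : ¬ 2 ∣ m := by omega
  have hP : Nat.card (P : Subgroup G) = 4 := P.card_eq_of_card_eq_pow_mul (k := 2) hcard hm2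
  have hPcomm : IsMulCommutative (P : Subgroup G) :=
    IsPGroup.isMulCommutative_of_card_eq_prime_sq (p := 2) hP
  have hdvd : 4 ∣ Nat.card (Subgroup.normalizer (P : Set G)) :=
    hP ▸ Subgroup.card_dvd_of_le Subgroup.le_normalizer
  have hle : Nat.card (Subgroup.normalizer (P : Set G)) ∣ 4 * m :=
    hcard ▸ Subgroup.card_subgroup_dvd_card _
  -- A self-normalizing abelian P would have a normal complement of order m by Burnside: 15 is
  -- excluded already, and a prime m gives a normal cyclic subgroup of odd order.
  have h4 : Nat.card (Subgroup.normalizer (P : Set G)) ≠ 4 := by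
    intro h
    have hNP : (P : Subgroup G) = Subgroup.normalizer (P : Set G) :=
      Subgroup.eq_of_le_of_card_ge Subgroup.le_normalizer (by rw [h]; exact hP.ge)
    have hNC : Subgroup.normalizer (P : Set G) ≤ Subgroup.centralizer (P : Set G) := by
      rw [← hNP]
      exact Subgroup.le_centralizer _
    have hK := (MonoidHom.ker_transferSylow_isComplement' P hNC).card_mul_card
    rw [show Nat.card (P : Subgroup G) = 4 from hP, hcard, mul_comm 4] at hK
    replace hK := Nat.eq_of_mul_eq_mul_right (by norm_num) hK
    by_cases h15 : m = 15
    · exact (hG.subgroup _).card_ne_fifteen (hK.trans h15)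
    · have hmp : m.Prime := by
        rcases hm with rfl | rfl | rfl
        · norm_num
        · norm_num
        · exact absurd rfl h15
      have : Fact m.Prime := ⟨hmp⟩
      have hcyc := isCyclic_of_prime_card hK
      have hb := hG.eq_bot_of_normal_of_isMulCommutative ⟨m, hcard⟩
        (MonoidHom.normal_ker (MonoidHom.transferSylow P hNC))
        inferInstance (by rw [hK]; exact Nat.odd_iff.2 (by omega))
      rw [hb, Subgroup.card_bot] at hK
      exact hmp.one_lt.ne hK
  -- An element of order 5 cannot act freely on the 3 involutions of P.
  have h5 : ¬ 5 ∣ Nat.card (Subgroup.normalizer (P : Set G)) := by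
    intro h
    obtain ⟨g, hg⟩ := exists_prime_orderOf_dvd_card'
      (G := Subgroup.normalizer (P : Set G)) 5 h
    have := hG.dvd_card_sub_one (g := g) (p := 5) (by rw [Subgroup.orderOf_coe, hg])
      (P : Subgroup G) (fun k hk => (Subgroup.mem_normalizer_iff.1 g.2 k).1 hk)
      (by rw [hP]; norm_num)
    rw [hP] at this
    norm_num at this
  obtain ⟨d, hd⟩ := hdvd
  rw [hd] at hle h4 h5 ⊢
  have hdm : d ∣ m := Nat.dvd_of_mul_dvd_mul_left (by norm_num) hle
  have hd15 : d ∣ 15 := by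
    rcases hm with rfl | rfl | rfl
    · exact hdm.trans (by norm_num)
    · exact hdm.trans (by norm_num)
    · exact hdm
  have hdle : d ≤ 15 := Nat.le_of_dvd (by norm_num) hd15
  interval_cases d <;> simp_all

theorem HasPrimeOrders.card_ne_twenty (hG : HasPrimeOrders G) : Nat.card G ≠ 20 := by
  intro h
  obtain ⟨P⟩ : Nonempty (Sylow 2 G) := inferInstance
  have h12 := hG.card_normalizer_sylow_two (m := 5) h (by norm_num) P
  have := Subgroup.card_subgroup_dvd_card (Subgroup.normalizer (P : Set G))
  rw [h12, h] at this
  norm_num at this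

/-! ### Identification of the remaining groups -/

theorem HasPrimeOrders.nonempty_mulEquiv_alternatingGroup_five (hG : HasPrimeOrders G)
    (h : Nat.card G = 60) : Nonempty (G ≃* alternatingGroup (Fin 5)) := by
  have : Fact (Nat.Prime 5) := ⟨Nat.prime_five⟩
  obtain ⟨P⟩ : Nonempty (Sylow 2 G) := inferInstance
  have h12 := hG.card_normalizer_sylow_two (m := 15) h (by norm_num) P
  set N := Subgroup.normalizer (P : Set G) with hN
  refine nonempty_mulEquiv_alternatingGroup N (n := 5) ?_ ?_ (by rw [h]; rfl)
  · have := N.card_mul_index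
    rw [h12, h] at this
    omega
  obtain ⟨g, hg⟩ := exists_prime_orderOf_dvd_card' (G := G) 5 (by rw [h]; norm_num)
  set K := N.normalCore with hK
  have hconj : ∀ k ∈ K, g * k * g⁻¹ ∈ K := fun k hk => N.normalCore_normal.conj_mem k hk g
  have hdvd : Nat.card K ∣ 12 := h12 ▸ Subgroup.card_dvd_of_le N.normalCore_le
  have hle : Nat.card K ≤ 12 := Nat.le_of_dvd (by norm_num) hdvd
  have h5 : ¬ 5 ∣ Nat.card K := fun h' => by
    have := h'.trans hdvd
    norm_num at this
  have h1 := hG.dvd_card_sub_one hg K hconj h5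
  -- Divisors of 12 congruent to 1 modulo 5.
  have h16 : Nat.card K = 1 ∨ Nat.card K = 6 := by
    generalize Nat.card K = c at *
    interval_cases c <;> omega
  rcases h16 with h16 | h16
  · exact Subgroup.card_eq_one.1 h16
  exfalso
  -- A core of order 6 would contain at least 5 elements of order 2 and 5 of order 3.
  have key : ∀ q : ℕ, [Fact q.Prime] → q ≠ 5 → q ∣ 6 → 5 ≤ {k | k ∈ K ∧ orderOf k = q}.ncard := by
    intro q hq hq5 hq6
    refine Nat.le_of_dvd ?_ (hG.dvd_ncard_orderOf_eq hq5.symm hg K hconj)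
    rw [Set.ncard_pos]
    obtain ⟨k, hk⟩ := exists_prime_orderOf_dvd_card' (G := K) q (by rwa [h16])
    exact ⟨k, k.2, by rw [Subgroup.orderOf_coe, hk]⟩
  have h2 := key 2 (by norm_num) (by norm_num)
  have h3 := key 3 (by norm_num) (by norm_num)
  have hdisj : Disjoint {k | k ∈ K ∧ orderOf k = 2} {k | k ∈ K ∧ orderOf k = 3} := by
    rw [Set.disjoint_left]
    rintro k ⟨-, hk⟩ ⟨-, hk'⟩
    omega
  have hun := Set.ncard_union_eq hdisj
  have hsub : ({k | k ∈ K ∧ orderOf k = 2} ∪ {k | k ∈ K ∧ orderOf k = 3}).ncard ≤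
      (K : Set G).ncard := by
    refine Set.ncard_le_ncard ?_
    rintro k (⟨hk, -⟩ | ⟨hk, -⟩) <;> exact hk
  rw [show (K : Set G).ncard = 6 from h16] at hsub
  omega

/-- G acts on the 4 cosets of a Sylow 3-subgroup, whose core is normal, abelian and odd, hence
trivial. -/
theorem HasPrimeOrders.nonempty_mulEquiv_alternatingGroup_four (hG : HasPrimeOrders G)
    (h : Nat.card G = 12) : Nonempty (G ≃* alternatingGroup (Fin 4)) := by
  obtain ⟨N, hN⟩ := Sylow.exists_subgroup_card_pow_prime (G := G) 3 (n := 1) (by rw [h]; norm_num)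
  refine nonempty_mulEquiv_alternatingGroup N (n := 4) ?_ ?_ (by rw [h]; rfl)
  · have := N.card_mul_index
    rw [hN, h] at this
    omega
  have hle := N.normalCore_le
  have hcyc : IsCyclic N := isCyclic_of_prime_card (p := 3) (by rw [hN, pow_one])
  refine hG.eq_bot_of_normal_of_isMulCommutative (by rw [h]; norm_num) N.normalCore_normal ?_ ?_
  · refine ⟨⟨fun a b => Subtype.ext ?_⟩⟩
    have hN' : IsMulCommutative N := inferInstance
    have hab := hN'.is_comm.comm ⟨a, hle a.2⟩ ⟨b, hle b.2⟩
    simpa only [Subtype.ext_iff, Subgroup.coe_mul] using hab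
  · refine Odd.of_dvd_nat ?_ (Subgroup.card_dvd_of_le hle)
    rw [hN]
    decide

theorem HasPrimeOrders.nonempty_mulEquiv_dihedralGroup (hG : HasPrimeOrders G) {p : ℕ}
    [hp : Fact p.Prime] (h : Nat.card G = 2 * p) : Nonempty (G ≃* DihedralGroup p) := by
  rcases hp.out.eq_two_or_odd' with rfl | hodd
  · obtain ⟨a, b, ha, ha1, hb, hab, hc⟩ :=
      hG.exists_commute_of_sq_dvd_card 2 (by rw [h]; norm_num)
    refine _root_.nonempty_mulEquiv_dihedralGroup (orderOf_eq_prime ha ha1) (by rw [← sq, hb])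
      ?_ hab h
    rw [hc.symm.eq, mul_inv_cancel_right, eq_inv_iff_mul_eq_one, ← sq, ha]
  · obtain ⟨K, hK, hKc⟩ := exists_normal_of_minFac (G := G) (p := 2) h
      (by rw [← even_iff_two_dvd, Nat.not_even_iff_odd]; exact hodd)
      (by rw [h, Nat.minFac_eq_two_iff]; exact dvd_mul_right 2 p)
    obtain ⟨b, hb⟩ := exists_prime_orderOf_dvd_card' (G := G) 2 (by rw [h]; exact dvd_mul_right 2 p)
    obtain ⟨a, ha⟩ := exists_prime_orderOf_dvd_card' (G := K) p (by rw [hKc])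
    have hb2 : b ^ 2 = 1 := hb ▸ pow_orderOf_eq_one b
    have hb1 : b ≠ 1 := fun h1 => by simp [h1] at hb
    have hcyc := isCyclic_of_prime_card hKc
    refine _root_.nonempty_mulEquiv_dihedralGroup (a := (a : G)) (by rw [Subgroup.orderOf_coe, ha])
      (by rw [← sq, hb2]) ?_ ?_ h
    · exact conj_eq_inv_of_odd hG inferInstance (by rw [hKc]; exact hodd) hb2 hb1
        (fun k hk => hK.conj_mem k hk b) a.2
    · intro hmem
      have hbK : b ∈ K := (Subgroup.zpowers_le.2 a.2) hmem
      have := Subgroup.orderOf_dvd_natCard K hbK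
      rw [hb, hKc, ← even_iff_two_dvd] at this
      exact (Nat.not_even_iff_odd.2 hodd) this

end Orders

/-! ### Groups satisfying the basis -/

section Basis

variable {G : Type*} [Group G]

theorem DIdentity.finite_of_omega {n : ℕ} (h : (omega n).HoldsIn G) : Finite G := by
  by_contra hinf
  rw [not_finite_iff_infinite] at hinf
  obtain ⟨i, j, hij, -, he⟩ := (omega_holdsIn_iff n).1 h (Infinite.natEmbedding G)
  exact hij.ne ((Infinite.natEmbedding G).injective he)

theorem pow_eq_self_of_pow_eq_one {a : G} {n : ℕ} (k : ℕ) (h : a ^ n = 1) :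
    a ^ (n * k + 1) = a := by
  rw [pow_succ, pow_mul, h, one_pow, one_mul]

theorem DIdentity.not_eight_dvd_card_of_beta [Finite G] (hG : HasPrimeOrders G)
    (h : beta.HoldsIn G) : ¬ 8 ∣ Nat.card G := by
  intro h8
  rw [beta_holdsIn_iff] at h
  obtain ⟨K, hK⟩ := Sylow.exists_subgroup_card_pow_prime (G := G) 2 (n := 3) h8
  have hsq : ∀ k : K, k * k = 1 := by
    intro k
    refine Subtype.ext ?_
    rw [Subgroup.coe_mul, ← sq]
    refine hG.pow_eq_one_of_pow_pow_eq_one Nat.prime_two (n := 3) ?_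
    rw [← Subgroup.coe_pow, ← hK, pow_card_eq_one', Subgroup.coe_one]
  have hex : ∀ s : Finset K, s.card < 8 → ∃ k, k ∉ s := by
    intro s hs
    by_contra! hall
    have : Fintype K := Fintype.ofFinite K
    have h1 : s = Finset.univ := Finset.eq_univ_iff_forall.2 hall
    rw [h1, Finset.card_univ, ← Nat.card_eq_fintype_card, hK] at hs
    norm_num at hs
  have hinv : ∀ k : K, k⁻¹ = k := fun k => inv_eq_of_mul_eq_one_left (hsq k)
  have hpow : ∀ k : K, k ≠ 1 → (k : G) ^ 15 ≠ 1 := by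
    intro k hk
    have h2 : (k : G) ^ 2 = 1 := by rw [sq, ← Subgroup.coe_mul, hsq, Subgroup.coe_one]
    rw [show 15 = 2 * 7 + 1 from rfl, pow_eq_self_of_pow_eq_one 7 h2]
    simpa using hk
  have hmul : ∀ k l : K, k * l = 1 → l = k := fun k l h =>
    (eq_inv_of_mul_eq_one_right h).trans (hinv k)
  classical
  obtain ⟨a, ha⟩ := hex {1} (by simp)
  obtain ⟨b, hb⟩ := hex {1, a} (Finset.card_le_two.trans_lt (by norm_num))
  -- c is independent of a and b in the elementary abelian group K, so no product listed in `beta`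
  -- vanishes.
  obtain ⟨c, hc⟩ := hex {1, a, b, a * b} (Finset.card_le_four.trans_lt (by norm_num))
  simp only [Finset.mem_insert, Finset.mem_singleton, not_or] at ha hb hc
  have hab : a * b ≠ 1 := fun h => hb.2 (hmul a b h)
  have hac : a * c ≠ 1 := fun h => hc.2.1 (hmul a c h)
  have hbc : b * c ≠ 1 := fun h => hc.2.2.1 (hmul b c h)
  have habc : a * b * c ≠ 1 := fun h => hc.2.2.2 (hmul (a * b) c h)
  have := h a b c (hpow a ha) (hpow b hb.1) (hpow c hc.1) (hpow _ hab) (hpow _ hac) (hpow _ hbc)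
  simp only [← Subgroup.coe_mul, OneMemClass.coe_eq_one] at this
  have ha1 := ha
  have hb1 := hb.1
  have hc1 := hc.1
  tauto

theorem DIdentity.not_nine_dvd_card_of_gamma [Finite G] (hG : HasPrimeOrders G)
    (h : gamma.HoldsIn G) : ¬ 9 ∣ Nat.card G := by
  intro h9
  rw [gamma_holdsIn_iff] at h
  obtain ⟨a, b, ha, ha1, hb, hab, hc⟩ := hG.exists_commute_of_sq_dvd_card 3 h9
  have hmul : ∀ n : ℕ, a ^ n * b ≠ 1 := fun n hn =>
    hab ⟨-n, by simpa using (eq_inv_of_mul_eq_one_right hn).symm⟩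
  have hcube : ∀ n : ℕ, (a ^ n * b) ^ 3 = 1 := fun n => by
    rw [(hc.pow_left n).mul_pow, hb, ← pow_mul, mul_comm n, pow_mul, ha, one_pow, one_mul]
  have h10 : ∀ x : G, x ^ 3 = 1 → x ≠ 1 → x ^ 10 ≠ 1 := fun x hx hx1 => by
    rwa [show 10 = 3 * 3 + 1 from rfl, pow_eq_self_of_pow_eq_one 3 hx]
  have hb1 : b ≠ 1 := by simpa using hmul 0
  have hsq := h a b (h10 a ha ha1) (h10 b hb hb1)
    (fun he => hab (he ▸ Subgroup.mem_zpowers a))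
    (h10 _ (by simpa using hcube 1) (by simpa using hmul 1))
  -- a²b has cube 1, and `gamma` makes its square 1.
  refine hmul 2 ?_
  have := hcube 2
  rwa [pow_succ, hsq, one_mul] at this

theorem DIdentity.not_twentyFive_dvd_card_of_epsilon [Finite G] (hG : HasPrimeOrders G)
    (h : epsilon.HoldsIn G) : ¬ 25 ∣ Nat.card G := by
  intro h25
  have : Fact (Nat.Prime 5) := ⟨Nat.prime_five⟩
  rw [epsilon_holdsIn_iff] at h
  -- The names are exchanged so that a lies outside ⟨b⟩: the coset a⟨b⟩ then has only elements of
  -- order 5, violating `epsilon`.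
  obtain ⟨b, a, hb, hb1, ha, hab, hc⟩ := hG.exists_commute_of_sq_dvd_card 5 h25
  have hmul : ∀ n : ℕ, a * b ^ n ≠ 1 := fun n hn =>
    hab ⟨-n, by simpa using (eq_inv_of_mul_eq_one_left hn).symm⟩
  have hfive : ∀ n : ℕ, (a * b ^ n) ^ 5 = 1 := fun n => by
    rw [(hc.symm.pow_right n).mul_pow, ha, ← pow_mul, mul_comm n, pow_mul, hb, one_pow, one_mul]
  have h6 : ∀ n : ℕ, (a * b ^ n) ^ 6 ≠ 1 := fun n => by
    rw [show 6 = 5 * 1 + 1 from rfl, pow_eq_self_of_pow_eq_one 1 (hfive n)]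
    exact hmul n
  refine h6 4 (h a b (by simpa using h6 0) ?_ (by simpa using h6 1) (h6 2) (h6 3))
  rwa [show 6 = 5 * 1 + 1 from rfl, pow_eq_self_of_pow_eq_one 1 hb]

theorem card_dvd_sixty [Finite G] (hG : ∀ a : G, a ^ 2 = 1 ∨ a ^ 3 = 1 ∨ a ^ 5 = 1)
    (h8 : ¬ 8 ∣ Nat.card G) (h9 : ¬ 9 ∣ Nat.card G) (h25 : ¬ 25 ∣ Nat.card G) :
    Nat.card G ∣ 60 := by
  rw [Nat.dvd_iff_prime_pow_dvd_dvd]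
  intro p k hp hk
  rcases Nat.eq_zero_or_pos k with rfl | hk0
  · simp
  have : Fact p.Prime := ⟨hp⟩
  obtain ⟨a, ha⟩ := exists_prime_orderOf_dvd_card' (G := G) p ((dvd_pow_self p hk0.ne').trans hk)
  have hbound : ∀ m, ¬ p ^ (m + 1) ∣ Nat.card G → k ≤ m := fun m hm => by
    by_contra! hlt
    exact hm ((pow_dvd_pow p hlt).trans hk)
  have hp235 : p = 2 ∨ p = 3 ∨ p = 5 := by
    rw [← Nat.prime_dvd_prime_iff_eq hp Nat.prime_two, ← Nat.prime_dvd_prime_iff_eq hp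
      Nat.prime_three, ← Nat.prime_dvd_prime_iff_eq hp Nat.prime_five, ← ha]
    simpa only [orderOf_dvd_iff_pow_eq_one] using hG a
  rcases hp235 with rfl | rfl | rfl
  · exact (pow_dvd_pow 2 (hbound 2 h8)).trans (by norm_num)
  · exact (pow_dvd_pow 3 (hbound 1 h9)).trans (by norm_num)
  · exact (pow_dvd_pow 5 (hbound 1 h25)).trans (by norm_num)

end Basis

/-! ### Sections of the alternating group of degree five -/

namespace alternatingGroupFive

theorem isSection_of_prime_card {H : Type*} [Group H] (p : ℕ) [Fact p.Prime] (hp : p ∣ 60)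
    (h : Nat.card H = p) : IsSection H (alternatingGroup (Fin 5)) := by
  obtain ⟨K, hK⟩ := Sylow.exists_subgroup_card_pow_prime (G := alternatingGroup (Fin 5)) p (n := 1)
    (by rwa [pow_one, nat_card])
  exact .of_mulEquiv (mulEquivOfPrimeCardEq h (by rw [hK, pow_one]))
    (.of_injective K.subtype K.subtype_injective)

theorem isSection_dihedralGroup {p : ℕ} (hp : p = 2 ∨ p = 3 ∨ p = 5) :
    IsSection (DihedralGroup p) (alternatingGroup (Fin 5)) := by
  have : Fact (Nat.Prime 5) := ⟨Nat.prime_five⟩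
  suffices h : ∃ a b : alternatingGroup (Fin 5), orderOf a = p ∧ b * b = 1 ∧
      b * a * b⁻¹ = a⁻¹ ∧ ∀ k < p, a ^ k ≠ b by
    obtain ⟨a, b, ha, hb, hab, hpow⟩ := h
    have hb' : b ∉ Subgroup.zpowers a := by
      classical
      simpa [mem_zpowers_iff_mem_range_orderOf, ha] using hpow
    obtain ⟨φ, hφ⟩ := exists_injective_dihedralGroup ha hb hab hb'
    exact .of_injective φ hφ
  rcases hp with rfl | rfl | rfl
  · exact ⟨⟨c[0, 1] * c[2, 3], mem_alternatingGroup.2 (by decide +kernel)⟩,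
      ⟨c[0, 2] * c[1, 3], mem_alternatingGroup.2 (by decide +kernel)⟩,
      orderOf_eq_prime (by decide +kernel) (by decide +kernel), by decide +kernel,
      by decide +kernel, by decide +kernel⟩
  · exact ⟨⟨c[0, 1, 2], mem_alternatingGroup.2 (by decide +kernel)⟩,
      -- The factor (3 4) makes the reflection of the triangle 0, 1, 2 even.
      ⟨c[0, 1] * c[3, 4], mem_alternatingGroup.2 (by decide +kernel)⟩,
      orderOf_eq_prime (by decide +kernel) (by decide +kernel), by decide +kernel,
      by decide +kernel, by decide +kernel⟩
  · exact ⟨⟨c[0, 1, 2, 3, 4], mem_alternatingGroup.2 (by decide +kernel)⟩,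
      -- The map i ↦ −i modulo 5, which inverts the rotation.
      ⟨c[1, 4] * c[2, 3], mem_alternatingGroup.2 (by decide +kernel)⟩,
      orderOf_eq_prime (by decide +kernel) (by decide +kernel), by decide +kernel,
      by decide +kernel, by decide +kernel⟩

theorem isSection_alternatingGroup_four :
    IsSection (alternatingGroup (Fin 4)) (alternatingGroup (Fin 5)) := by
  have e : Fin 4 ≃ ({0, 1, 2, 3} : Finset (Fin 5)) := Fintype.equivOfCardEq (by decide)
  exact .of_mulEquiv (Equiv.altCongrHom e)
    (.of_injective (alternatingGroup.ofSubtype _) alternatingGroup.ofSubtype_injective)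

theorem isSection_of_card_dvd_sixty {H : Type*} [Group H] [Finite H] (hH : HasPrimeOrders H)
    (hcard : Nat.card H ∣ 60) : IsSection H (alternatingGroup (Fin 5)) := by
  have : Fact (Nat.Prime 5) := ⟨Nat.prime_five⟩
  have hmem : Nat.card H ∈ Nat.divisors 60 := Nat.mem_divisors.2 ⟨hcard, by norm_num⟩
  rw [show Nat.divisors 60 = {1, 2, 3, 4, 5, 6, 10, 12, 15, 20, 30, 60} by decide +kernel] at hmem
  simp only [Finset.mem_insert, Finset.mem_singleton] at hmem
  have hdihedral : ∀ p : ℕ, p = 2 ∨ p = 3 ∨ p = 5 → [Fact p.Prime] → Nat.card H = 2 * p →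
      IsSection H (alternatingGroup (Fin 5)) := by
    intro p hp _ h
    obtain ⟨e⟩ := hH.nonempty_mulEquiv_dihedralGroup h
    exact .of_mulEquiv e (isSection_dihedralGroup hp)
  rcases hmem with h | h | h | h | h | h | h | h | h | h | h | h
  · have := (Nat.card_eq_one_iff_unique.1 h).1
    exact .of_injective (1 : H →* alternatingGroup (Fin 5)) (Function.injective_of_subsingleton _)
  · exact isSection_of_prime_card 2 (by norm_num) h
  · exact isSection_of_prime_card 3 (by norm_num) h
  · exact hdihedral 2 (by norm_num) h
  · exact isSection_of_prime_card 5 (by norm_num) h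
  · exact hdihedral 3 (by norm_num) h
  · exact hdihedral 5 (by norm_num) h
  · obtain ⟨e⟩ := hH.nonempty_mulEquiv_alternatingGroup_four h
    exact .of_mulEquiv e isSection_alternatingGroup_four
  · exact absurd h hH.card_ne_fifteen
  · exact absurd h hH.card_ne_twenty
  · exact absurd h hH.card_ne_thirty
  · obtain ⟨e⟩ := hH.nonempty_mulEquiv_alternatingGroup_five h
    exact .of_injective e.toMonoidHom e.injective

theorem isSection_of_basis {H : Type*} [Group H] (h : ∀ δ ∈ DIdentity.basisA5, δ.HoldsIn H) :
    IsSection H (alternatingGroup (Fin 5)) := by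
  simp only [DIdentity.basisA5, Set.mem_insert_iff, Set.mem_singleton_iff, forall_eq_or_imp,
    forall_eq] at h
  obtain ⟨hω, hα, hβ, hγ, hε⟩ := h
  have := DIdentity.finite_of_omega hω
  rw [DIdentity.alpha_holdsIn_iff] at hα
  have hH := HasPrimeOrders.of_pow_eq_one hα
  exact isSection_of_card_dvd_sixty hH (card_dvd_sixty hα
    (DIdentity.not_eight_dvd_card_of_beta hH hβ) (DIdentity.not_nine_dvd_card_of_gamma hH hγ)
    (DIdentity.not_twentyFive_dvd_card_of_epsilon hH hε))

end alternatingGroupFive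

theorem theorem1 :
    IsDBasis.{u, 0} DIdentity.basisA5 (alternatingGroup (Fin 5)) ∧
      ∀ (H : Type u) [Group H], (∀ δ ∈ DIdentity.basisA5, δ.HoldsIn H) →
        IsSection H (alternatingGroup (Fin 5)) := by
  have h : ∀ (H : Type u) [Group H], (∀ δ ∈ DIdentity.basisA5, δ.HoldsIn H) →
      IsSection H (alternatingGroup (Fin 5)) :=
    fun H _ hH => alternatingGroupFive.isSection_of_basis hH
  exact ⟨⟨alternatingGroupFive.basis_holdsIn, fun H _ hH => .of_isSection (h H hH)⟩, h⟩
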